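/- **Setting.** Fix a first-order signature with an interpretation on a set $\mathcal V$ of values (the theory $T$, e.g. linear integer or real arithmetic); truth of formulas refers to it, and $\mathbf x\models_T\varphi$ means that $\varphi$ is true under the assignment $\mathbf x$, for every interpretation of the uninterpreted symbols that $\varphi$ may contain. A *reactive program game structure* $\mathcal G=(T,\mathbb I,\mathbb X,L,\mathit{Inv},\delta)$ consists of disjoint finite sets $\mathbb I$ of input and $\mathbb X$ of program variables, a finite set $L$ of locations, formulas $\mathit{Inv}(l)$ over $\mathbb X$, and a finite set $\delta$ of transitions $(l,g,u,l')$, where the guard $g$ is a quantifier-free formula over $\mathbb X\cup\mathbb I$ and the update $u$ maps every $x\in\mathbb X$ to a term over $\mathbb X\cup\mathbb I$, such that: (1) for every $l$ the guards of the transitions from $l$ cover all assignments, and distinct guards are disjoint; (2) $(l,g,u,l_1),(l,g,u,l_2)\in\delta$ implies $l_1=l_2$; (3) for every $l$ and $\mathbf x\models_T\mathit{Inv}(l)$ there are $(l,g,u,l')\in\delta$ and an input assignment $\mathbf i$ with $\mathbf x\uplus\mathbf i\models_T g$ and $\mathbf x'\models_T\mathit{Inv}(l')$, where $\mathbf x'(x)$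 is the value of $u(x)$ under $\mathbf x\uplus\mathbf i$. Its semantics $[\![\mathcal G]\!]$ is the game with states $(l,\mathbf x)$, $\mathbf x\models_T\mathit{Inv}(l)$: in $(l,\mathbf x)$ Player Env chooses an enabled input assignment $\mathbf i$, then Player Sys chooses an update $u$ for which there is $(l,g,u,l')\in\delta$ with $\mathbf x\uplus\mathbf i\models_T g$ and $\mathbf x'\models_T\mathit{Inv}(l')$, and the next state is $(l',\mathbf x')$; the input $\mathbf i$ is *enabled* if such a $u$ exists. Strategies depend on the history of states (and, for Sys, on the current enabled input) and choose enabled moves. $\mathit{Attr}_{[\![\mathcal G]\!],p}(R)$ is the set of states from which Player $p$ has a strategy such that every play consistent with it visits $R$. For $d$ mapping locations to formulas over $\mathbb X$, $[\![d]\!]$ is the set of states $(l,\mathbf x)$ with $\mathbf x\models_T d(l)$, and $\{l\mapsto\varphi\}$ maps $l$ to $\varphi$ and all other locations to $\bot$. Put $$\mathit{CPre}_{\mathcal G,\mathit{Env}}(d)(l)=\mathit{Inv}(l)\land\exists\mathbb I.\bigwedge_{(l,g,u,l')\in\delta}\bigl(g\land\mathit{Inv}(l')[u]\to d(l')[u]\bigr),$$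 $$\mathit{CPre}_{\mathcal G,\mathit{Sys}}(d)(l)=\mathit{Inv}(l)\land\forall\mathbb I.\bigvee_{(l,g,u,l')\in\delta}\bigl(g\land\mathit{Inv}(l')[u]\land d(l')[u]\bigr).$$ An *acceleration lemma* over $\mathbb X$ is a triple of formulas $(\mathit{base},\mathit{step},\mathit{conc})$, with $\mathit{base},\mathit{conc}$ over $\mathbb X$ and $\mathit{step}$ over $\mathbb X\cup\mathbb X'$, such that every infinite sequence of assignments that starts in $\mathit{conc}$ and whose consecutive members are related by $\mathit{step}$ meets $\mathit{base}$, and such that $\mathbf x\models_T\mathit{conc}$, $\mathbf x\not\models_T\mathit{base}$ and $(\mathbf x,\mathbf x')\models_T\mathit{step}$ imply $\mathbf x'\models_T\mathit{conc}$. The *loop game* of $\mathcal G$ at $l$ has an additional location $l_{\mathit{End}}\notin L$ with invariant $\mathit{Inv}(l)$; every transition into $l$ is redirected to $l_{\mathit{End}}$, and $l_{\mathit{End}}$ has the single self-loop $(l_{\mathit{End}},\top,\mathrm{id},l_{\mathit{End}})$. The procedures $\mathsf{AccA}$ and $\mathsf{IterA}$ compute with formulas that may contain uninterpreted lemma predicates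 and constants. * $\mathsf{AccA}(\mathcal G,p,l,d)$ picks a fresh triple $(b,st,c)$ of predicate symbols and fresh constants $E=\{e_x\mid x\in\mathbb X\}$, lets $\mathcal G_{\mathit{loop}}$ be the loop game at $l$ and $d_{\mathit{loop}}=d\cup\{l_{\mathit{End}}\mapsto st(E,\mathbb X)\}$, computes $(\Psi_{\mathit{Rec}},a):=\mathsf{IterA}(\mathcal G_{\mathit{loop}},p,\top,d_{\mathit{loop}})[E\mapsto\mathbb X]$, and returns $(\Psi,\;c(\mathbb X)\land\mathit{Inv}(l))$ with $$\Psi=\bigl(\forall\mathbb X.\,\mathit{Inv}(l)\land b(\mathbb X)\to d(l)\bigr)\land\bigl(\forall\mathbb X.\,\mathit{Inv}(l)\land\lnot d(l)\land c(\mathbb X)\to\Psi_{\mathit{Rec}}\land a(l)\bigr).$$ * $\mathsf{IterA}(\mathcal G,p,\Psi,d)$, as decided by arbitrary heuristics, either returns $(\Psi,d)$, or computes $(\Psi_{\mathit{Rec}},\varphi):=\mathsf{AccA}(\mathcal G,p,l,d)$ for some location $l$ and returns $\mathsf{IterA}(\mathcal G,p,\Psi\land\Psi_{\mathit{Rec}},d[l\mapsto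 d(l)\lor\varphi])$, or returns $\mathsf{IterA}(\mathcal G,p,\Psi,d\lor\mathit{CPre}_{\mathcal G,p}(d))$. For a map $\lambda$ from lemma symbol triples to acceleration lemmas over $\mathbb X$, $\psi[\lambda]$ is obtained from $\psi$ by replacing every atom formed with a symbol $b$, $st$ or $c$ by the instance of $\mathit{base}$, $\mathit{step}$ or $\mathit{conc}$ at its arguments. **Lemma.** Let $\mathcal G$ be a reactive program game structure, $p\in\{\mathit{Sys},\mathit{Env}\}$, $l\in L$, and let $d$ map locations to formulas over $\mathbb X$ without uninterpreted symbols. If $p=\mathit{Env}$, assume that in every state of $[\![\mathcal G]\!]$ every input assignment is enabled. If $\mathsf{AccA}(\mathcal G,p,l,d)$ returns $(\Psi,\varphi)$, then for every map $\lambda$ of the lemma symbols used in $\Psi$ and $\varphi$ to acceleration lemmas over $\mathbb X$ such that $\Psi[\lambda]$ is valid, $$[\![\{l\mapsto\varphi[\lambda]\}]\!]\subseteq\mathit{Attr}_{[\![\mathcal G]\!],p}([\![d]\!]).$$ -/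

import Mathlib

open FirstOrder.Language

universe u v w

/-! ### Two-player games of infinite duration -/

/-- The two players. -/
inductive Player
  | env
  | sys

/-- A game structure `(S, Mₑ, Mₛ, ρ)`: every state has a successor, and the moves of the two
players determine the successor. -/
structure GameStructure where
  State : Type w
  EnvMove : Type w
  SysMove : Type v
  rel : State → EnvMove → SysMove → State → Prop
  exists_succ : ∀ s, ∃ e a s', rel s e a s'
  succ_unique : ∀ s e a s₁ s₂, rel s e a s₁ → rel s e a s₂ → s₁ = s₂

namespace GameStructure

variable (A : GameStructure.{v, w})

/-- The moves of the environment that are enabled in a state. -/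
def enabledEnv (s : A.State) : Set A.EnvMove := {e | ∃ a s', A.rel s e a s'}

/-- The moves of the system that are enabled in a state after a move of the environment. -/
def enabledSys (s : A.State) (e : A.EnvMove) : Set A.SysMove := {a | ∃ s', A.rel s e a s'}

/-- A strategy of the environment. A nonempty history `s₀, …, sₙ` is given as the list
`s₀, …, sₙ₋₁` of the past states together with the current state `sₙ`. -/
structure EnvStrategy where
  move : List A.State → A.State → A.EnvMove
  enabled : ∀ h s, move h s ∈ A.enabledEnv s

/-- A strategy of the system. It has to answer every enabled move of the environment by an
enabled move. (After a disabled environment move no system move is enabled.) -/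
structure SysStrategy where
  move : List A.State → A.State → A.EnvMove → A.SysMove
  enabled : ∀ h s, ∀ e ∈ A.enabledEnv s, move h s e ∈ A.enabledSys s e

variable {A}

/-- `π` is the play from `s` in which the players follow `σe` and `σs`. -/
def IsOutcome (s : A.State) (σe : A.EnvStrategy) (σs : A.SysStrategy) (π : ℕ → A.State) : Prop :=
  π 0 = s ∧ ∀ k, ∃ e a,
    σe.move ((List.range k).map π) (π k) = e ∧
    σs.move ((List.range k).map π) (π k) e = a ∧
    A.rel (π k) e a (π (k + 1))

/-- The plays from `s` that are consistent with a strategy of the environment. -/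
def playsEnv (s : A.State) (σe : A.EnvStrategy) : Set (ℕ → A.State) :=
  {π | ∃ σs : A.SysStrategy, IsOutcome s σe σs π}

/-- The plays from `s` that are consistent with a strategy of the system. -/
def playsSys (s : A.State) (σs : A.SysStrategy) : Set (ℕ → A.State) :=
  {π | ∃ σe : A.EnvStrategy, IsOutcome s σe σs π}

variable (A)

/-- The attractor of a player for the set of states `R`: the states from which some strategy of
the player enforces that `R` is visited. -/
def Attr : Player → Set A.State → Set A.State
  | Player.env, R => {s | ∃ σe : A.EnvStrategy, ∀ π ∈ playsEnv s σe, ∃ k, π k ∈ R}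
  | Player.sys, R => {s | ∃ σs : A.SysStrategy, ∀ π ∈ playsSys s σs, ∃ k, π k ∈ R}

end GameStructure

/-! ### Reactive program games

The theory is given by its signature `𝓛` and by its interpretation on the set `V` of values. The
program variables are indexed by `Fin n` and the input variables by `Fin m`; a formula over
program and input variables has its free variables in `Fin n ⊕ Fin m`. -/

/-- The assignment `x'` that an update `u` yields under the assignments `x` and `i`. -/
def applyUpdate {𝓛 : FirstOrder.Language.{u, v}} {V : Type w} [𝓛.Structure V] {n m : ℕ}
    (u : Fin n → 𝓛.Term (Fin n ⊕ Fin m)) (x : Fin n → V) (i : Fin m → V) : Fin n → V :=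
  fun y => (u y).realize (Sum.elim x i)

/-- Transitions `(l, g, u, l')` of a reactive program game structure with locations `Loc`. -/
structure Transition (𝓛 : FirstOrder.Language.{u, v}) (n m : ℕ) (Loc : Type) where
  src : Loc
  guard : 𝓛.Formula (Fin n ⊕ Fin m)
  update : Fin n → 𝓛.Term (Fin n ⊕ Fin m)
  tgt : Loc

/-- Reactive program game structures with locations `Loc`. (Finiteness of `Loc` follows from
`finite` and `guard_total`.) -/
structure RPG (𝓛 : FirstOrder.Language.{u, v}) (V : Type w) [𝓛.Structure V] (n m : ℕ) (Loc : Type) where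
  inv : Loc → 𝓛.Formula (Fin n)
  trans : Set (Transition 𝓛 n m Loc)
  finite : trans.Finite
  guard_qf : ∀ t ∈ trans, t.guard.IsQF
  guard_total : ∀ (l : Loc) (x : Fin n → V) (i : Fin m → V),
    ∃ t ∈ trans, t.src = l ∧ t.guard.Realize (Sum.elim x i)
  guard_disjoint : ∀ t₁ ∈ trans, ∀ t₂ ∈ trans, t₁.src = t₂.src → t₁.guard ≠ t₂.guard →
    ∀ (x : Fin n → V) (i : Fin m → V),
      ¬ (t₁.guard.Realize (Sum.elim x i) ∧ t₂.guard.Realize (Sum.elim x i))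
  tgt_unique : ∀ t₁ ∈ trans, ∀ t₂ ∈ trans, t₁.src = t₂.src → t₁.guard = t₂.guard →
    t₁.update = t₂.update → t₁.tgt = t₂.tgt
  no_deadlock : ∀ (l : Loc) (x : Fin n → V), (inv l).Realize x →
    ∃ t ∈ trans, t.src = l ∧ ∃ i : Fin m → V,
      t.guard.Realize (Sum.elim x i) ∧ (inv t.tgt).Realize (applyUpdate t.update x i)

namespace RPG

variable {𝓛 : FirstOrder.Language.{u, v}} {V : Type w} [𝓛.Structure V] {n m : ℕ} {Loc : Type}

/-- The states of a reactive program game structure. -/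
def State (G : RPG 𝓛 V n m Loc) : Type w :=
  {s : Loc × (Fin n → V) // (G.inv s.1).Realize s.2}

/-- The updates that occur in a reactive program game structure. -/
def Updates (G : RPG 𝓛 V n m Loc) : Type u :=
  {a : Fin n → 𝓛.Term (Fin n ⊕ Fin m) // ∃ t ∈ G.trans, t.update = a}

/-- The semantics of a reactive program game structure. -/
def sem (G : RPG 𝓛 V n m Loc) : GameStructure.{u, w} where
  State := G.State
  EnvMove := Fin m → V
  SysMove := G.Updates
  rel s i a s' := ∃ t ∈ G.trans, t.src = s.1.1 ∧ t.update = a.1 ∧ t.tgt = s'.1.1 ∧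
    t.guard.Realize (Sum.elim s.1.2 i) ∧ s'.1.2 = applyUpdate a.1 s.1.2 i
  exists_succ := by
    rintro ⟨⟨l, x⟩, hx⟩
    obtain ⟨t, ht, hl, i, hg, hi⟩ := G.no_deadlock l x hx
    exact ⟨i, ⟨t.update, t, ht, rfl⟩, ⟨(t.tgt, _), hi⟩, t, ht, hl, rfl, rfl, hg, rfl⟩
  succ_unique := by
    rintro ⟨⟨l, x⟩, hx⟩ i ⟨a, ha⟩ ⟨⟨l₁, x₁⟩, h₁⟩ ⟨⟨l₂, x₂⟩, h₂⟩
      ⟨t, ht, htl, htu, htt, htg, htx⟩ ⟨r, hr, hrl, hru, hrt, hrg, hrx⟩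
    dsimp only at *
    have hg : t.guard = r.guard := by
      by_contra hne
      exact G.guard_disjoint t ht r hr (htl.trans hrl.symm) hne x i ⟨htg, hrg⟩
    have := G.tgt_unique t ht r hr (htl.trans hrl.symm) hg (htu.trans hru.symm)
    subst htt hrt htx hrx
    exact Subtype.ext (Prod.ext this rfl)

end RPG

/-! ### Formulas with uninterpreted symbols -/

/-- The symbols `b`, `st`, `c` of the `k`-th triple of lemma symbols, for `n` program variables. -/
inductive LemmaRel (n : ℕ) : ℕ → Type
  | base (k : ℕ) : LemmaRel n n
  | step (k : ℕ) : LemmaRel n (n + n)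
  | conc (k : ℕ) : LemmaRel n n

/-- The language of the uninterpreted lemma symbols. -/
def lemmaLang (n : ℕ) : FirstOrder.Language.{0, 0} := ⟨fun _ => Empty, LemmaRel n⟩

/-- The signature of the theory together with the uninterpreted lemma symbols. -/
abbrev accLang (𝓛 : FirstOrder.Language.{u, v}) (n : ℕ) : FirstOrder.Language.{u, v} := 𝓛.sum (lemmaLang n)

/-- The uninterpreted constants: `(k, x)` is the constant `e_x` that belongs to the `k`-th triple
of lemma symbols. In formulas they are treated as variables that are never quantified. -/
abbrev Cst (n : ℕ) : Type := ℕ × Fin n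

/-- Constraints: no free program variables. -/
abbrev Constraint (𝓛 : FirstOrder.Language.{u, v}) (n : ℕ) := (accLang 𝓛 n).Formula (Cst n)

/-- Formulas over the program variables, with uninterpreted symbols. -/
abbrev AccFormula (𝓛 : FirstOrder.Language.{u, v}) (n : ℕ) := (accLang 𝓛 n).Formula (Cst n ⊕ Fin n)

section Syntactic

variable {𝓛 : FirstOrder.Language.{u, v}} {n m : ℕ}

/-- A formula over the program variables as a formula that may contain uninterpreted symbols. -/
def liftFormula (φ : 𝓛.Formula (Fin n)) : AccFormula 𝓛 n :=
  (LHom.sumInl.onFormula φ).relabel Sum.inr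

/-- A guard, with the inputs as the outermost summand of the variables. -/
def liftGuard (g : 𝓛.Formula (Fin n ⊕ Fin m)) :
    (accLang 𝓛 n).Formula ((Cst n ⊕ Fin n) ⊕ Fin m) :=
  (LHom.sumInl.onFormula g).relabel (Sum.map Sum.inr id)

/-- The formula `φ[u]`: every program variable `x` is replaced by the term `u x`. -/
def substUpdate (u : Fin n → 𝓛.Term (Fin n ⊕ Fin m)) (φ : AccFormula 𝓛 n) :
    (accLang 𝓛 n).Formula ((Cst n ⊕ Fin n) ⊕ Fin m) :=
  BoundedFormula.subst φ (Sum.elim (fun e => Term.var (Sum.inl (Sum.inl e)))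
    (fun x => (LHom.sumInl.onTerm (u x)).relabel (Sum.map Sum.inr id)))

/-- The terms of the program variables, as arguments of lemma symbols (no bound variables). -/
def progTerm (x : Fin n) : (accLang 𝓛 n).Term ((Cst n ⊕ Fin n) ⊕ Fin 0) :=
  Term.var (Sum.inl (Sum.inr x))

/-- The terms of the `k`-th uninterpreted constants, as arguments of lemma symbols. -/
def cstTerm (k : ℕ) (x : Fin n) : (accLang 𝓛 n).Term ((Cst n ⊕ Fin n) ⊕ Fin 0) :=
  Term.var (Sum.inl (Sum.inl (k, x)))

/-- The formula `b(𝕏)` for the `k`-th triple of lemma symbols. -/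
def baseAtom (𝓛 : FirstOrder.Language.{u, v}) (n k : ℕ) : AccFormula 𝓛 n :=
  BoundedFormula.rel (L := accLang 𝓛 n) (l := n) (Sum.inr (LemmaRel.base k)) progTerm

/-- The formula `st(E, 𝕏)` for the `k`-th triple of lemma symbols and constants `E`. -/
def stepAtom (𝓛 : FirstOrder.Language.{u, v}) (n k : ℕ) : AccFormula 𝓛 n :=
  BoundedFormula.rel (L := accLang 𝓛 n) (l := n + n) (Sum.inr (LemmaRel.step k))
    (Fin.append (cstTerm k) progTerm)

/-- The formula `c(𝕏)` for the `k`-th triple of lemma symbols. -/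
def concAtom (𝓛 : FirstOrder.Language.{u, v}) (n k : ℕ) : AccFormula 𝓛 n :=
  BoundedFormula.rel (L := accLang 𝓛 n) (l := n) (Sum.inr (LemmaRel.conc k)) progTerm

/-- The substitution `[E ↦ 𝕏]` for the `k`-th constants, on a single constant. -/
def cstToProg (k : ℕ) (e : Cst n) : Cst n ⊕ Fin n :=
  if e.1 = k then Sum.inr e.2 else Sum.inl e

/-- The substitution `[E ↦ 𝕏]` on constraints. -/
def Constraint.cstToProg (k : ℕ) (Ψ : Constraint 𝓛 n) : AccFormula 𝓛 n :=
  Formula.relabel (_root_.cstToProg k) Ψ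

/-- The substitution `[E ↦ 𝕏]` on formulas over the program variables. -/
def AccFormula.cstToProg (k : ℕ) (φ : AccFormula 𝓛 n) : AccFormula 𝓛 n :=
  Formula.relabel (Sum.elim (_root_.cstToProg k) Sum.inr) φ

end Syntactic

/-! ### Controllable predecessors and loop games -/

namespace RPG

variable {𝓛 : FirstOrder.Language.{u, v}} {V : Type w} [𝓛.Structure V] {n m : ℕ} {Loc : Type}

/-- The transitions that leave a location. -/
abbrev Out (G : RPG 𝓛 V n m Loc) (l : Loc) : Type (max u v) := {t // t ∈ G.trans ∧ t.src = l}

instance (G : RPG 𝓛 V n m Loc) (l : Loc) : Finite (G.Out l) :=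
  (G.finite.subset fun _ h => h.1 : {t | t ∈ G.trans ∧ t.src = l}.Finite).to_subtype

/-- The symbolic controllable predecessor operators of the two players. -/
noncomputable def cpre (G : RPG 𝓛 V n m Loc) :
    Player → (Loc → AccFormula 𝓛 n) → Loc → AccFormula 𝓛 n
  | Player.env, d, l => liftFormula (G.inv l) ⊓ Formula.iExs (Fin m)
      (Formula.iInf fun t : G.Out l =>
        (liftGuard t.1.guard ⊓ substUpdate t.1.update (liftFormula (G.inv t.1.tgt))).imp
          (substUpdate t.1.update (d t.1.tgt)))
  | Player.sys, d, l => liftFormula (G.inv l) ⊓ Formula.iAlls (Fin m)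
      (Formula.iSup fun t : G.Out l =>
        liftGuard t.1.guard ⊓ substUpdate t.1.update (liftFormula (G.inv t.1.tgt)) ⊓
          substUpdate t.1.update (d t.1.tgt))

/-- The transitions of the loop game at `l`. The fresh location is `none`. -/
def loopTrans (G : RPG 𝓛 V n m Loc) (l : Loc) : Set (Transition 𝓛 n m (Option Loc)) :=
  {r | ∃ t ∈ G.trans, t.tgt ≠ l ∧ r = ⟨some t.src, t.guard, t.update, some t.tgt⟩} ∪
  {r | ∃ t ∈ G.trans, t.tgt = l ∧ r = ⟨some t.src, t.guard, t.update, none⟩} ∪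
  {⟨none, ⊤, fun x => Term.var (Sum.inl x), none⟩}

/-- The loop game at `l`, with the fresh location `none`. -/
def loopGame (G : RPG 𝓛 V n m Loc) (l : Loc) : RPG 𝓛 V n m (Option Loc) where
  inv
    | none => G.inv l
    | some l' => G.inv l'
  trans := G.loopTrans l
  finite := by
    refine ((Set.Finite.subset (G.finite.image
      fun t => (⟨some t.src, t.guard, t.update, some t.tgt⟩ : Transition 𝓛 n m (Option Loc))) ?_).union
      (Set.Finite.subset (G.finite.image
      fun t => (⟨some t.src, t.guard, t.update, none⟩ : Transition 𝓛 n m (Option Loc))) ?_)).union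
      (Set.finite_singleton _)
    · rintro _ ⟨t, ht, -, rfl⟩
      exact ⟨t, ht, rfl⟩
    · rintro _ ⟨t, ht, -, rfl⟩
      exact ⟨t, ht, rfl⟩
  guard_qf := by
    rintro _ ((⟨t, ht, -, rfl⟩ | ⟨t, ht, -, rfl⟩) | rfl)
    · exact G.guard_qf t ht
    · exact G.guard_qf t ht
    · exact BoundedFormula.IsQF.top
  guard_total := by
    rintro (_ | l') x i
    · exact ⟨_, Or.inr rfl, rfl, Formula.realize_top.2 trivial⟩
    · obtain ⟨t, ht, rfl, hg⟩ := G.guard_total l' x i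
      by_cases h : t.tgt = l
      · exact ⟨_, Or.inl (Or.inr ⟨t, ht, h, rfl⟩), rfl, hg⟩
      · exact ⟨_, Or.inl (Or.inl ⟨t, ht, h, rfl⟩), rfl, hg⟩
  guard_disjoint := by
    rintro _ ((⟨t, ht, -, rfl⟩ | ⟨t, ht, -, rfl⟩) | rfl)
      _ ((⟨r, hr, -, rfl⟩ | ⟨r, hr, -, rfl⟩) | rfl) hs hne x i
    all_goals first
      | exact G.guard_disjoint t ht r hr (Option.some.inj hs) hne x i
      | exact absurd rfl hne
      | simp at hs
  tgt_unique := by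
    rintro _ ((⟨t, ht, h, rfl⟩ | ⟨t, ht, h, rfl⟩) | rfl)
      _ ((⟨r, hr, k, rfl⟩ | ⟨r, hr, k, rfl⟩) | rfl) hs hg hu
    all_goals first
      | rfl
      | (have := G.tgt_unique t ht r hr (Option.some.inj hs) hg hu
         simp_all)
      | simp at hs
  no_deadlock := by
    rintro (_ | l') x hx
    · obtain ⟨t, -, -, i, -, -⟩ := G.no_deadlock l x hx
      exact ⟨_, Or.inr rfl, rfl, i, Formula.realize_top.2 trivial, hx⟩
    · obtain ⟨t, ht, rfl, i, hg, hi⟩ := G.no_deadlock l' x hx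
      by_cases h : t.tgt = l
      · subst h
        exact ⟨_, Or.inl (Or.inr ⟨t, ht, rfl, rfl⟩), rfl, i, hg, hi⟩
      · exact ⟨_, Or.inl (Or.inl ⟨t, ht, h, rfl⟩), rfl, i, hg, hi⟩

end RPG

/-! ### The acceleration procedures -/

section Procedures

variable {𝓛 : FirstOrder.Language.{u, v}} {V : Type w} [𝓛.Structure V] {n m : ℕ}

/-- The symbolic goal `d ∪ {l_End ↦ st(E, 𝕏)}` of the loop game. -/
def loopGoal {Loc : Type} (k : ℕ) (d : Loc → AccFormula 𝓛 n) : Option Loc → AccFormula 𝓛 n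
  | none => stepAtom 𝓛 n k
  | some l => d l

/-- The constraint that is built from the result `(Ψrec, a)` of the recursive computation. -/
noncomputable def accConstraint {Loc : Type} (G : RPG 𝓛 V n m Loc) (l : Loc) (k : ℕ)
    (d : Loc → AccFormula 𝓛 n) (Ψrec : Constraint 𝓛 n) (a : Option Loc → AccFormula 𝓛 n) :
    Constraint 𝓛 n :=
  Formula.iAlls (Fin n) ((liftFormula (G.inv l) ⊓ baseAtom 𝓛 n k).imp (d l)) ⊓
  Formula.iAlls (Fin n) ((liftFormula (G.inv l) ⊓ (d l).not ⊓ concAtom 𝓛 n k).imp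
    (Ψrec.cstToProg k ⊓ (a (some l)).cstToProg k))

open Classical in
mutual

/-- `AccA s G p l d Ψ φ s'`: some run of the procedure on `(G, p, l, d)` returns `(Ψ, φ)`. The
indices in `s` are those of the symbols in use before the run, and those in `s'` the ones in use
after it. -/
inductive AccA : Finset ℕ → {Loc : Type} → RPG 𝓛 V n m Loc → Player → Loc →
    (Loc → AccFormula 𝓛 n) → Constraint 𝓛 n → AccFormula 𝓛 n → Finset ℕ → Prop
  | intro {s s' : Finset ℕ} {Loc : Type} {G : RPG 𝓛 V n m Loc} {p : Player} {l : Loc}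
      {d : Loc → AccFormula 𝓛 n} {Ψrec : Constraint 𝓛 n} {a : Option Loc → AccFormula 𝓛 n}
      (k : ℕ) (fresh : k ∉ s)
      (run : IterA (insert k s) (G.loopGame l) p ⊤ (loopGoal k d) Ψrec a s') :
      AccA s G p l d (accConstraint G l k d Ψrec a) (concAtom 𝓛 n k ⊓ liftFormula (G.inv l)) s'

/-- `IterA s G p Ψ d Ψ' a s'`: some run of the procedure on `(G, p, Ψ, d)` returns `(Ψ', a)`. The
heuristics that decide when to terminate, and when and where to accelerate, are arbitrary: each of
the three rules may be used at any time. -/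
inductive IterA : Finset ℕ → {Loc : Type} → RPG 𝓛 V n m Loc → Player → Constraint 𝓛 n →
    (Loc → AccFormula 𝓛 n) → Constraint 𝓛 n → (Loc → AccFormula 𝓛 n) → Finset ℕ → Prop
  | finish {s : Finset ℕ} {Loc : Type} {G : RPG 𝓛 V n m Loc} {p : Player} {Ψ : Constraint 𝓛 n}
      {d : Loc → AccFormula 𝓛 n} : IterA s G p Ψ d Ψ d s
  | accelerate {s s₁ s₂ : Finset ℕ} {Loc : Type} {G : RPG 𝓛 V n m Loc} {p : Player}
      {Ψ Ψrec Ψ' : Constraint 𝓛 n} {d a : Loc → AccFormula 𝓛 n} {φ : AccFormula 𝓛 n} (l : Loc)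
      (run : AccA s G p l d Ψrec φ s₁)
      (rest : IterA s₁ G p (Ψ ⊓ Ψrec) (Function.update d l (d l ⊔ φ)) Ψ' a s₂) :
      IterA s G p Ψ d Ψ' a s₂
  | step {s s' : Finset ℕ} {Loc : Type} {G : RPG 𝓛 V n m Loc} {p : Player}
      {Ψ Ψ' : Constraint 𝓛 n} {d a : Loc → AccFormula 𝓛 n}
      (rest : IterA s G p Ψ (fun l => d l ⊔ G.cpre p d l) Ψ' a s') :
      IterA s G p Ψ d Ψ' a s'

end

end Procedures

/-! ### Acceleration lemmas and their substitution for the lemma symbols -/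

/-- Acceleration lemmas over the program variables. In `step`, the variables `Sum.inl x` stand
for the unprimed and the variables `Sum.inr x` for the primed copies. -/
structure AccLemma (𝓛 : FirstOrder.Language.{u, v}) (V : Type w) [𝓛.Structure V] (n : ℕ) where
  base : 𝓛.Formula (Fin n)
  step : 𝓛.Formula (Fin n ⊕ Fin n)
  conc : 𝓛.Formula (Fin n)
  reaches_base : ∀ α : ℕ → Fin n → V, conc.Realize (α 0) →
    (∀ i, step.Realize (Sum.elim (α i) (α (i + 1)))) → ∃ k, base.Realize (α k)
  conc_step : ∀ x x' : Fin n → V, conc.Realize x → ¬ base.Realize x →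
    step.Realize (Sum.elim x x') → conc.Realize x'

section Instantiate

variable {𝓛 : FirstOrder.Language.{u, v}} {V : Type w} [𝓛.Structure V] {n : ℕ}

/-- Terms contain no lemma symbols, hence are terms over the signature of the theory. -/
def plainTerm {α : Type} : (accLang 𝓛 n).Term α → 𝓛.Term α
  | Term.var a => Term.var a
  | Term.func (Sum.inl f) ts => Term.func f fun i => plainTerm (ts i)
  | Term.func (Sum.inr f) _ => Empty.elim f

/-- The formula `χ[t_x | x]` for terms `t_x` that may contain bound variables. -/
def substTerms {ξ α : Type} {j : ℕ} (χ : 𝓛.Formula ξ) (t : ξ → 𝓛.Term (α ⊕ Fin j)) :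
    𝓛.BoundedFormula α j :=
  (BoundedFormula.subst χ t).relabel (id : α ⊕ Fin j → α ⊕ Fin j)

/-- The atomic formula that a lemma symbol forms with its arguments is replaced by the instance
of the respective component of the lemma. -/
def substLemmaRel (lam : ℕ → AccLemma 𝓛 V n) {α : Type} {j : ℕ} :
    {r : ℕ} → LemmaRel n r → (Fin r → 𝓛.Term (α ⊕ Fin j)) → 𝓛.BoundedFormula α j
  | _, LemmaRel.base k, ts => substTerms (lam k).base ts
  | _, LemmaRel.step k, ts => substTerms (lam k).step
      (Sum.elim (fun x => ts (Fin.castAdd n x)) (fun x => ts (Fin.natAdd n x)))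
  | _, LemmaRel.conc k, ts => substTerms (lam k).conc ts

/-- The formula `ψ[λ]`. -/
def instLemmas (lam : ℕ → AccLemma 𝓛 V n) {α : Type} :
    {j : ℕ} → (accLang 𝓛 n).BoundedFormula α j → 𝓛.BoundedFormula α j
  | _, BoundedFormula.falsum => BoundedFormula.falsum
  | _, BoundedFormula.equal t₁ t₂ => BoundedFormula.equal (plainTerm t₁) (plainTerm t₂)
  | _, BoundedFormula.rel (Sum.inl R) ts => BoundedFormula.rel R fun i => plainTerm (ts i)
  | _, BoundedFormula.rel (Sum.inr R) ts => substLemmaRel lam R fun i => plainTerm (ts i)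
  | _, BoundedFormula.imp φ₁ φ₂ => (instLemmas lam φ₁).imp (instLemmas lam φ₂)
  | _, BoundedFormula.all φ => (instLemmas lam φ).all

/-- A formula of the theory (with uninterpreted constants) is valid: it is true for every
interpretation of the constants. -/
def Valid (V : Type w) [𝓛.Structure V] (Ψ : 𝓛.Formula (Cst n)) : Prop :=
  ∀ η : Cst n → V, Ψ.Realize η

/-- The assignment `x` entails `φ`: `φ` is true for every interpretation of the constants. -/
def Entails (x : Fin n → V) (φ : 𝓛.Formula (Cst n ⊕ Fin n)) : Prop :=
  ∀ η : Cst n → V, φ.Realize (Sum.elim η x)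

end Instantiate

namespace RPG

variable {𝓛 : FirstOrder.Language.{u, v}} {V : Type w} [𝓛.Structure V] {n m : ℕ} {Loc : Type}

/-- The set of states `⟦d⟧` of an element `d` of the symbolic domain. -/
def denote (G : RPG 𝓛 V n m Loc) (d : Loc → 𝓛.Formula (Fin n)) : Set G.sem.State :=
  {s : G.State | (d s.1.1).Realize s.1.2}

/-- The set of states `⟦{l ↦ φ}⟧`. -/
def denoteAt (G : RPG 𝓛 V n m Loc) (l : Loc) (φ : 𝓛.Formula (Cst n ⊕ Fin n)) :
    Set G.sem.State :=
  {s : G.State | s.1.1 = l ∧ Entails s.1.2 φ}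

/-- Every input is enabled in every state. -/
def InputEnabled (G : RPG 𝓛 V n m Loc) : Prop :=
  ∀ s : G.sem.State, G.sem.enabledEnv s = Set.univ

end RPG

-- Strategies are kept out of the induction. The proof works with the least set that contains the
-- goal and is closed under one-step forcing. Its defining universal property is an induction
-- principle, and only the easy inclusion into the strategic attractor is needed
-- (`lfpAttr_subset_Attr`). Substituting lemmas for the symbols amounts to interpreting the symbols
-- in an expansion of the theory's structure (`realize_instLemmas`). Soundness is then an induction
-- over runs of the two procedures, for one fixed expansion but for every interpretation `η` of the
-- constants (`AccA.sound`). The core is the acceleration rule (`accelerate_subset_lfpAttr`). Let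
-- `W` be the attractor in the outer game, and suppose `x` satisfies the conclusion but `(l, x)` is
-- outside `W`. The recursive result, read with `E := x`, says that in the loop game the player can
-- force from `(l, x)` either `d` or a return to `l` in a `step`-successor of `x`. If all
-- `step`-successors satisfying the invariant were in `W`, then `W`, extended at the fresh location
-- by these successors, would be closed under forcing in the loop game and would contain its goal,
-- which puts `(l, x)` in `W`. So some `step`-successor is again outside `W`. It satisfies the
-- conclusion too, because `base` implies `d` at `l`. Iterating gives an infinite `step`-sequence
-- that avoids `base`, which an acceleration lemma forbids.

namespace GameStructure

-- Attractors as least fixed points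

variable (A : GameStructure.{v, w})

/-- The states from which a player can force that the next state belongs to `X`. -/
def pre : Player → Set A.State → Set A.State
  | Player.env, X => {s | ∃ e ∈ A.enabledEnv s, ∀ a t, A.rel s e a t → t ∈ X}
  | Player.sys, X => {s | ∀ e ∈ A.enabledEnv s, ∃ a t, A.rel s e a t ∧ t ∈ X}

/-- The least set of states that contains `R` and is closed under `A.pre p`. -/
def lfpAttr (p : Player) (R : Set A.State) : Set A.State :=
  {s | ∀ X : Set A.State, R ⊆ X → A.pre p X ⊆ X → s ∈ X}

variable {A}

theorem pre_mono {p : Player} {X Y : Set A.State} (h : X ⊆ Y) : A.pre p X ⊆ A.pre p Y := by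
  cases p with
  | env => exact fun s ⟨e, he, hs⟩ => ⟨e, he, fun a s' hr => h (hs a s' hr)⟩
  | sys =>
    intro s hs e he
    obtain ⟨a, s', hr, hX⟩ := hs e he
    exact ⟨a, s', hr, h hX⟩

theorem lfpAttr_subset {p : Player} {R X : Set A.State} (hR : R ⊆ X) (hX : A.pre p X ⊆ X) :
    A.lfpAttr p R ⊆ X :=
  fun _ hs => hs X hR hX

theorem subset_lfpAttr (p : Player) (R : Set A.State) : R ⊆ A.lfpAttr p R :=
  fun _ hs _ hR _ => hR hs

theorem pre_lfpAttr_subset (p : Player) (R : Set A.State) :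
    A.pre p (A.lfpAttr p R) ⊆ A.lfpAttr p R :=
  fun _ hs _ hR hX => hX (pre_mono (lfpAttr_subset hR hX) hs)

theorem lfpAttr_subset_lfpAttr {p : Player} {R R' : Set A.State} (h : R' ⊆ A.lfpAttr p R) :
    A.lfpAttr p R' ⊆ A.lfpAttr p R :=
  lfpAttr_subset h (pre_lfpAttr_subset p R)

-- From least fixed points to strategies

instance : Nonempty A.EnvStrategy := by
  choose e a s' h using A.exists_succ
  exact ⟨⟨fun _ s => e s, fun _ s => ⟨a s, s' s, h s⟩⟩⟩

theorem exists_response :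
    ∃ f : A.State → A.EnvMove → A.SysMove, ∀ s, ∀ e ∈ A.enabledEnv s, f s e ∈ A.enabledSys s e := by
  have : ∀ s e, ∃ a, e ∈ A.enabledEnv s → a ∈ A.enabledSys s e := by
    intro s e
    by_cases he : e ∈ A.enabledEnv s
    · obtain ⟨a, s', h⟩ := he
      exact ⟨a, fun _ => ⟨s', h⟩⟩
    · obtain ⟨_, a, _⟩ := A.exists_succ s
      exact ⟨a, fun h => absurd h he⟩
  choose f hf using this
  exact ⟨f, hf⟩

instance : Nonempty A.SysStrategy := by
  obtain ⟨f, hf⟩ := exists_response (A := A)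
  exact ⟨⟨fun _ => f, fun _ => hf⟩⟩

theorem subset_Attr (p : Player) (R : Set A.State) : R ⊆ A.Attr p R := by
  intro s hs
  cases p with
  | env => exact ⟨Classical.arbitrary _, fun π ⟨_, h⟩ => ⟨0, h.1 ▸ hs⟩⟩
  | sys => exact ⟨Classical.arbitrary _, fun π ⟨_, h⟩ => ⟨0, h.1 ▸ hs⟩⟩

theorem map_range_succ_eq_cons {α : Type*} (π : ℕ → α) (k : ℕ) :
    (List.range (k + 1)).map π = π 0 :: (List.range k).map fun j => π (j + 1) := by
  rw [List.range_succ_eq_map, List.map_cons, List.map_map]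
  rfl

/-- A history lists only the past states, so at time `0` the first state of the play is the current
one; this explains the default value. -/
theorem head?_map_range_getD {α : Type*} (π : ℕ → α) (k : ℕ) :
    ((List.range k).map π).head?.getD (π k) = π 0 := by
  cases k with
  | zero => rfl
  | succ k => rw [map_range_succ_eq_cons]; rfl

/-- The environment strategy that starts with the moves of `f` and then follows the strategy
`σ t`, where `t` is the second state of the play. -/
def EnvStrategy.cons (f : A.State → A.EnvMove) (hf : ∀ s, f s ∈ A.enabledEnv s)
    (σ : A.State → A.EnvStrategy) : A.EnvStrategy where
  move
    | [], s => f s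
    | _ :: h, s => (σ (h.head?.getD s)).move h s
  enabled
    | [], s => hf s
    | _ :: h, s => (σ (h.head?.getD s)).enabled h s

/-- The system strategy that starts with the moves of `f` and then follows the strategy
`σ t`, where `t` is the second state of the play. -/
def SysStrategy.cons (f : A.State → A.EnvMove → A.SysMove)
    (hf : ∀ s, ∀ e ∈ A.enabledEnv s, f s e ∈ A.enabledSys s e)
    (σ : A.State → A.SysStrategy) : A.SysStrategy where
  move
    | [], s, e => f s e
    | _ :: h, s, e => (σ (h.head?.getD s)).move h s e
  enabled
    | [], s => hf s
    | _ :: h, s => (σ (h.head?.getD s)).enabled h s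

/-- The rest of an environment strategy after a first state. -/
def EnvStrategy.tail (σ : A.EnvStrategy) (s₀ : A.State) : A.EnvStrategy where
  move h := σ.move (s₀ :: h)
  enabled h := σ.enabled (s₀ :: h)

/-- The rest of a system strategy after a first state. -/
def SysStrategy.tail (σ : A.SysStrategy) (s₀ : A.State) : A.SysStrategy where
  move h := σ.move (s₀ :: h)
  enabled h := σ.enabled (s₀ :: h)

/-- Play one forcing move, then the winning strategy that belongs to the state reached. The second
state of the play selects this strategy, and dropping the first state turns the play into one
consistent with it. -/
theorem pre_Attr_subset (p : Player) (R : Set A.State) : A.pre p (A.Attr p R) ⊆ A.Attr p R := by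
  classical
  intro s hs
  cases p with
  | env =>
    obtain ⟨e, he, hs⟩ := hs
    have hσ : ∀ t, ∃ σ : A.EnvStrategy, t ∈ A.Attr Player.env R →
        ∀ π ∈ playsEnv t σ, ∃ k, π k ∈ R := by
      intro t
      by_cases ht : t ∈ A.Attr Player.env R
      · obtain ⟨σ, h⟩ := ht
        exact ⟨σ, fun _ => h⟩
      · exact ⟨Classical.arbitrary _, fun h => absurd h ht⟩
    choose σ hσ using hσ
    obtain ⟨σ₀⟩ := (inferInstance : Nonempty A.EnvStrategy)
    -- A strategy must be enabled at every state, so away from `s` the first move is borrowed from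
    -- an arbitrary strategy.
    have hf : ∀ t, (if t = s then e else σ₀.move [] t) ∈ A.enabledEnv t := by
      intro t
      split_ifs with h
      · exact h ▸ he
      · exact σ₀.enabled [] t
    refine ⟨EnvStrategy.cons _ hf σ, ?_⟩
    rintro π ⟨σs, h0, hπ⟩
    obtain ⟨e', a, h1, h2, hr⟩ := hπ 0
    have he' : e' = e := by
      rw [← h1]
      simp [EnvStrategy.cons, h0]
    subst he'
    have h1R : π 1 ∈ A.Attr Player.env R := hs a _ (h0 ▸ hr)
    obtain ⟨k, hk⟩ := hσ _ h1R (fun j => π (j + 1)) ⟨σs.tail (π 0), rfl, fun k => by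
      obtain ⟨e, a, h1, h2, hr⟩ := hπ (k + 1)
      rw [map_range_succ_eq_cons] at h1 h2
      refine ⟨e, a, ?_, h2, hr⟩
      have := head?_map_range_getD (fun j => π (j + 1)) k
      simp only [EnvStrategy.cons] at h1
      rwa [this] at h1⟩
    exact ⟨k + 1, hk⟩
  | sys =>
    have hσ : ∀ t, ∃ σ : A.SysStrategy, t ∈ A.Attr Player.sys R →
        ∀ π ∈ playsSys t σ, ∃ k, π k ∈ R := by
      intro t
      by_cases ht : t ∈ A.Attr Player.sys R
      · obtain ⟨σ, h⟩ := ht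
        exact ⟨σ, fun _ => h⟩
      · exact ⟨Classical.arbitrary _, fun h => absurd h ht⟩
    choose σ hσ using hσ
    obtain ⟨g, hg⟩ := exists_response (A := A)
    have hf : ∀ t e, ∃ a, e ∈ A.enabledEnv t → a ∈ A.enabledSys t e ∧
        (t = s → ∃ s', A.rel t e a s' ∧ s' ∈ A.Attr Player.sys R) := by
      intro t e
      by_cases he : e ∈ A.enabledEnv t
      · by_cases h : t = s
        · subst h
          obtain ⟨a, s', hr, hs'⟩ := hs e he
          exact ⟨a, fun _ => ⟨⟨s', hr⟩, fun _ => ⟨s', hr, hs'⟩⟩⟩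
        · exact ⟨g t e, fun _ => ⟨hg t e he, fun h' => absurd h' h⟩⟩
      · exact ⟨g t e, fun h => absurd h he⟩
    choose f hf using hf
    refine ⟨SysStrategy.cons f (fun t e he => (hf t e he).1) σ, ?_⟩
    rintro π ⟨σe, h0, hπ⟩
    obtain ⟨e, a, h1, h2, hr⟩ := hπ 0
    obtain ⟨s', hr', hs'⟩ := (hf (π 0) e ⟨a, _, hr⟩).2 h0
    have ha : f (π 0) e = a := h2
    -- The chosen answer leads to some state of the attractor; determinism identifies that state
    -- with the actual successor.
    have h1R : π 1 ∈ A.Attr Player.sys R := by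
      rw [ha] at hr'
      exact A.succ_unique _ _ _ _ _ hr' hr ▸ hs'
    obtain ⟨k, hk⟩ := hσ _ h1R (fun j => π (j + 1)) ⟨σe.tail (π 0), rfl, fun k => by
      obtain ⟨e, a, h1, h2, hr⟩ := hπ (k + 1)
      rw [map_range_succ_eq_cons] at h1 h2
      refine ⟨e, a, h1, ?_, hr⟩
      have := head?_map_range_getD (fun j => π (j + 1)) k
      simp only [SysStrategy.cons] at h2
      rwa [this] at h2⟩
    exact ⟨k + 1, hk⟩

theorem lfpAttr_subset_Attr (p : Player) (R : Set A.State) : A.lfpAttr p R ⊆ A.Attr p R :=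
  lfpAttr_subset (subset_Attr p R) (pre_Attr_subset p R)

end GameStructure

/-! ### Semantics of formulas with lemma symbols -/

section Semantics

variable {𝓛 : FirstOrder.Language.{u, v}} {V : Type w} [𝓛.Structure V] {n m : ℕ}

/-- The interpretation of a lemma symbol by the respective component of an acceleration lemma. -/
def LemmaRel.interp (lam : ℕ → AccLemma 𝓛 V n) : {r : ℕ} → LemmaRel n r → (Fin r → V) → Prop
  | _, LemmaRel.base k, xs => (lam k).base.Realize xs
  | _, LemmaRel.step k, xs => (lam k).step.Realize
      (Sum.elim (fun y => xs (Fin.castAdd n y)) (fun y => xs (Fin.natAdd n y)))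
  | _, LemmaRel.conc k, xs => (lam k).conc.Realize xs

/-- The interpretation of the lemma symbols by acceleration lemmas. -/
@[reducible]
def lemmaStructure (lam : ℕ → AccLemma 𝓛 V n) : (lemmaLang n).Structure V where
  funMap f := Empty.elim f
  RelMap R := LemmaRel.interp lam R

theorem realize_plainTerm [(lemmaLang n).Structure V] {α : Type} (v : α → V) :
    ∀ t : (accLang 𝓛 n).Term α, (plainTerm t).realize v = t.realize v
  | Term.var _ => rfl
  | Term.func (Sum.inl f) ts => by
    simp only [plainTerm, Term.realize_func, realize_plainTerm v (ts _)]
    rfl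
  | Term.func (Sum.inr f) _ => Empty.elim f

theorem realize_substTerms {ξ α : Type} {j : ℕ} (χ : 𝓛.Formula ξ) (t : ξ → 𝓛.Term (α ⊕ Fin j))
    (v : α → V) (xs : Fin j → V) :
    (substTerms χ t).Realize v xs ↔ χ.Realize fun a => (t a).realize (Sum.elim v xs) := by
  unfold substTerms
  -- Relabelling yields `j + 0` bound variables; fixing `n := 0` lets this unify with `j`.
  rw [show ((BoundedFormula.subst χ t).relabel (id : α ⊕ Fin j → α ⊕ Fin j)).Realize v xs ↔ _ from
    BoundedFormula.realize_relabel (n := 0), BoundedFormula.realize_subst, Formula.Realize]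
  exact iff_of_eq (congrArg₂ _ rfl (Subsingleton.elim _ _))

/-- Substitution lemma for predicates: it allows the soundness argument to speak only of interpreted
symbols. -/
theorem realize_instLemmas (lam : ℕ → AccLemma 𝓛 V n) {α : Type} :
    ∀ {j : ℕ} (φ : (accLang 𝓛 n).BoundedFormula α j) (v : α → V) (xs : Fin j → V),
      letI := lemmaStructure lam
      (instLemmas lam φ).Realize v xs ↔ φ.Realize v xs := by
  let := lemmaStructure lam
  intro j φ
  induction φ with
  | falsum => exact fun _ _ => Iff.rfl
  | equal t₁ t₂ =>
    intro v xs
    simp only [instLemmas, BoundedFormula.Realize, realize_plainTerm]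
  | rel R ts =>
    intro v xs
    rcases R with R | R
    · simp only [instLemmas, BoundedFormula.Realize, realize_plainTerm]
      rfl
    · cases R with
      | base k =>
        simp only [instLemmas, substLemmaRel, realize_substTerms, realize_plainTerm]
        rfl
      | conc k =>
        simp only [instLemmas, substLemmaRel, realize_substTerms, realize_plainTerm]
        rfl
      | step k =>
        simp only [instLemmas, substLemmaRel, realize_substTerms]
        refine iff_of_eq (congrArg (lam k).step.Realize (funext ?_))
        rintro (y | y) <;> exact realize_plainTerm _ _
  | imp φ₁ φ₂ ih₁ ih₂ =>
    intro v xs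
    simp only [instLemmas, BoundedFormula.realize_imp, ih₁, ih₂]
  | all φ ih =>
    intro v xs
    simp only [instLemmas, BoundedFormula.realize_all, ih]

/-- The interpretation `η` of the constants, with the `k`-th constants interpreted by `x`. -/
def setCst (k : ℕ) (η : Cst n → V) (x : Fin n → V) (e : Cst n) : V :=
  if e.1 = k then x e.2 else η e

theorem elim_comp_cstToProg (k : ℕ) (η : Cst n → V) (x : Fin n → V) :
    Sum.elim η x ∘ cstToProg k = setCst k η x := by
  funext e
  by_cases h : e.1 = k <;> simp [cstToProg, setCst, h]

-- Truth of the symbolic formulas under a fixed interpretation of the lemma symbols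

variable [(lemmaLang n).Structure V]

/-- The interpretation of the symbol `b` of the `k`-th triple. -/
def BaseHolds (k : ℕ) (x : Fin n → V) : Prop :=
  FirstOrder.Language.Structure.RelMap (L := lemmaLang n) (LemmaRel.base k) x

/-- The interpretation of the symbol `st` of the `k`-th triple. -/
def StepHolds (k : ℕ) (x y : Fin n → V) : Prop :=
  FirstOrder.Language.Structure.RelMap (L := lemmaLang n) (LemmaRel.step k) (Fin.append x y)

/-- The interpretation of the symbol `c` of the `k`-th triple. -/
def ConcHolds (k : ℕ) (x : Fin n → V) : Prop :=
  FirstOrder.Language.Structure.RelMap (L := lemmaLang n) (LemmaRel.conc k) x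

theorem realize_liftFormula (φ : 𝓛.Formula (Fin n)) (η : Cst n → V) (x : Fin n → V) :
    (liftFormula φ).Realize (Sum.elim η x) ↔ φ.Realize x := by
  rw [liftFormula, Formula.realize_relabel, LHom.realize_onFormula, Sum.elim_comp_inr]

theorem realize_liftGuard (g : 𝓛.Formula (Fin n ⊕ Fin m)) (η : Cst n → V) (x : Fin n → V)
    (i : Fin m → V) :
    (liftGuard g).Realize (Sum.elim (Sum.elim η x) i) ↔ g.Realize (Sum.elim x i) := by
  rw [liftGuard, Formula.realize_relabel, LHom.realize_onFormula, Sum.elim_comp_map,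
    Sum.elim_comp_inr, Function.comp_id]

theorem realize_substUpdate (u : Fin n → 𝓛.Term (Fin n ⊕ Fin m)) (φ : AccFormula 𝓛 n)
    (η : Cst n → V) (x : Fin n → V) (i : Fin m → V) :
    (substUpdate u φ).Realize (Sum.elim (Sum.elim η x) i) ↔
      φ.Realize (Sum.elim η (applyUpdate u x i)) := by
  rw [substUpdate, Formula.Realize, BoundedFormula.realize_subst, Formula.Realize]
  refine iff_of_eq (congrArg₂ _ (funext ?_) rfl)
  rintro (e | y)
  · rfl
  · simp only [Sum.elim_inr, Term.realize_relabel, LHom.realize_onTerm, Sum.elim_comp_map,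
      Sum.elim_comp_inr, Function.comp_id]
    rfl

theorem realize_baseAtom (k : ℕ) (η : Cst n → V) (x : Fin n → V) :
    (baseAtom 𝓛 n k).Realize (Sum.elim η x) ↔ BaseHolds k x :=
  Iff.rfl

theorem realize_concAtom (k : ℕ) (η : Cst n → V) (x : Fin n → V) :
    (concAtom 𝓛 n k).Realize (Sum.elim η x) ↔ ConcHolds k x :=
  Iff.rfl

theorem realize_stepAtom (k : ℕ) (η : Cst n → V) (x : Fin n → V) :
    (stepAtom 𝓛 n k).Realize (Sum.elim η x) ↔ StepHolds k (fun y => η (k, y)) x := by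
  refine iff_of_eq (congrArg (FirstOrder.Language.Structure.RelMap (L := lemmaLang n) (M := V)
    (LemmaRel.step k : (lemmaLang n).Relations (n + n))) (funext fun y => ?_))
  refine Fin.addCases (fun y => ?_) (fun y => ?_) y
  · rw [Fin.append_left, Fin.append_left]
    rfl
  · rw [Fin.append_right, Fin.append_right]
    rfl

theorem Constraint.realize_cstToProg (k : ℕ) (Ψ : Constraint 𝓛 n) (η : Cst n → V)
    (x : Fin n → V) :
    (Ψ.cstToProg k).Realize (Sum.elim η x) ↔ Ψ.Realize (setCst k η x) := by
  rw [Constraint.cstToProg, Formula.realize_relabel, elim_comp_cstToProg]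

theorem AccFormula.realize_cstToProg (k : ℕ) (φ : AccFormula 𝓛 n) (η : Cst n → V)
    (x : Fin n → V) :
    (φ.cstToProg k).Realize (Sum.elim η x) ↔ φ.Realize (Sum.elim (setCst k η x) x) := by
  rw [AccFormula.cstToProg, Formula.realize_relabel, Sum.comp_elim, elim_comp_cstToProg,
    Sum.elim_comp_inr]

/-- The substitution `[E ↦ 𝕏]` puts the constants under the quantifier: the recursive result is
available for each start `x`, with `E` recording that same `x`. -/
theorem realize_accConstraint {Loc : Type} (G : RPG 𝓛 V n m Loc) (l : Loc) (k : ℕ)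
    (d : Loc → AccFormula 𝓛 n) (Ψrec : Constraint 𝓛 n) (a : Option Loc → AccFormula 𝓛 n)
    (η : Cst n → V) :
    (accConstraint G l k d Ψrec a).Realize η ↔
      (∀ x : Fin n → V, (G.inv l).Realize x → BaseHolds k x → (d l).Realize (Sum.elim η x)) ∧
      ∀ x : Fin n → V, (G.inv l).Realize x → ¬ (d l).Realize (Sum.elim η x) → ConcHolds k x →
        Ψrec.Realize (setCst k η x) ∧ (a (some l)).Realize (Sum.elim (setCst k η x) x) := by
  simp only [accConstraint, Formula.realize_inf, Formula.realize_iAlls, Formula.realize_imp,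
    Formula.realize_not, realize_liftFormula, realize_baseAtom, realize_concAtom,
    Constraint.realize_cstToProg, AccFormula.realize_cstToProg, and_imp]

-- Symbolic and semantic controllable predecessors

namespace RPG

variable {Loc : Type} (G : RPG 𝓛 V n m Loc)

theorem realize_cpre_env (d : Loc → AccFormula 𝓛 n) (l : Loc) (η : Cst n → V) (x : Fin n → V) :
    (G.cpre Player.env d l).Realize (Sum.elim η x) ↔ (G.inv l).Realize x ∧
      ∃ i : Fin m → V, ∀ t ∈ G.trans, t.src = l → t.guard.Realize (Sum.elim x i) →
        (G.inv t.tgt).Realize (applyUpdate t.update x i) →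
        (d t.tgt).Realize (Sum.elim η (applyUpdate t.update x i)) := by
  simp only [cpre, Formula.realize_inf, Formula.realize_iExs, Formula.realize_iInf,
    Formula.realize_imp, realize_liftFormula, realize_liftGuard, realize_substUpdate,
    Subtype.forall, and_imp]

theorem realize_cpre_sys (d : Loc → AccFormula 𝓛 n) (l : Loc) (η : Cst n → V) (x : Fin n → V) :
    (G.cpre Player.sys d l).Realize (Sum.elim η x) ↔ (G.inv l).Realize x ∧
      ∀ i : Fin m → V, ∃ t ∈ G.trans, t.src = l ∧ t.guard.Realize (Sum.elim x i) ∧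
        (G.inv t.tgt).Realize (applyUpdate t.update x i) ∧
        (d t.tgt).Realize (Sum.elim η (applyUpdate t.update x i)) := by
  simp only [cpre, Formula.realize_inf, Formula.realize_iAlls, Formula.realize_iSup,
    realize_liftFormula, realize_liftGuard, realize_substUpdate,
    Subtype.exists, exists_prop, and_assoc]

/-- The states that satisfy `d` when the constants are interpreted by `η`. -/
def denoteAcc (d : Loc → AccFormula 𝓛 n) (η : Cst n → V) : Set G.sem.State :=
  {s : G.State | (d s.1.1).Realize (Sum.elim η s.1.2)}

variable {G}

/-- For Env the symbolic operator accepts a disabled input vacuously, hence the assumption on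
inputs. For Sys it quantifies over all inputs, in particular over the enabled ones. -/
theorem denoteAcc_cpre_subset {p : Player} (hp : p = Player.env → G.InputEnabled)
    (d : Loc → AccFormula 𝓛 n) (η : Cst n → V) :
    G.denoteAcc (G.cpre p d) η ⊆ G.sem.pre p (G.denoteAcc d η) := by
  rintro ⟨⟨l, x⟩, hx⟩ hs
  cases p with
  | env =>
    obtain ⟨-, i, hi⟩ := (G.realize_cpre_env d l η x).1 hs
    refine ⟨i, hp rfl _ ▸ Set.mem_univ i, ?_⟩
    rintro ⟨a, ha⟩ ⟨⟨l', x'⟩, hx'⟩ ⟨t, ht, hsrc, hu, htgt, hg, hxx⟩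
    dsimp only at hsrc hu htgt hg hxx
    subst hu htgt hxx
    exact hi t ht hsrc hg hx'
  | sys =>
    obtain ⟨-, h⟩ := (G.realize_cpre_sys d l η x).1 hs
    rintro i -
    obtain ⟨t, ht, hsrc, hg, hinv, hd⟩ := h i
    exact ⟨⟨t.update, t, ht, rfl⟩, ⟨(t.tgt, _), hinv⟩, ⟨t, ht, hsrc, rfl, rfl, hg, rfl⟩, hd⟩

end RPG

-- Dependence on constants and freshness

/-- The truth of `φ` depends only on the constants with indices in `s`. -/
def CstSupported (V : Type w) [𝓛.Structure V] [(lemmaLang n).Structure V] (s : Finset ℕ)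
    (φ : AccFormula 𝓛 n) : Prop :=
  ∀ (η η' : Cst n → V) (x : Fin n → V), (∀ e : Cst n, e.1 ∈ s → η e = η' e) →
    (φ.Realize (Sum.elim η x) ↔ φ.Realize (Sum.elim η' x))

namespace CstSupported

variable {s s' : Finset ℕ} {φ ψ : AccFormula 𝓛 n}

theorem mono (h : CstSupported V s φ) (hs : s ⊆ s') : CstSupported V s' φ :=
  fun η η' x hη => h η η' x fun e he => hη e (hs he)

theorem sup (hφ : CstSupported V s φ) (hψ : CstSupported V s ψ) : CstSupported V s (φ ⊔ ψ) :=
  fun η η' x hη => by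
    rw [Formula.realize_sup, Formula.realize_sup, hφ η η' x hη, hψ η η' x hη]

theorem liftFormula (φ : 𝓛.Formula (Fin n)) : CstSupported V s (liftFormula φ) :=
  fun η η' x _ => by rw [realize_liftFormula, realize_liftFormula]

theorem conc_inf_liftFormula (k : ℕ) (φ : 𝓛.Formula (Fin n)) :
    CstSupported V s (concAtom 𝓛 n k ⊓ _root_.liftFormula φ) :=
  fun η η' x _ => by
    simp only [Formula.realize_inf, realize_concAtom, realize_liftFormula]

theorem stepAtom {k : ℕ} (hk : k ∈ s) : CstSupported V s (stepAtom 𝓛 n k) :=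
  fun η η' x hη => by
    rw [realize_stepAtom, realize_stepAtom, funext fun y => hη (k, y) hk]

theorem cpre {Loc : Type} (G : RPG 𝓛 V n m Loc) (p : Player) {d : Loc → AccFormula 𝓛 n}
    (hd : ∀ l, CstSupported V s (d l)) (l : Loc) : CstSupported V s (G.cpre p d l) :=
  fun η η' x hη => by
    cases p with
    | env => simp only [RPG.realize_cpre_env, fun l x => hd l η η' x hη]
    | sys => simp only [RPG.realize_cpre_sys, fun l x => hd l η η' x hη]

theorem loopGoal {Loc : Type} {d : Loc → AccFormula 𝓛 n} (hd : ∀ l, CstSupported V s (d l))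
    (k : ℕ) : ∀ l, CstSupported V (insert k s) (loopGoal k d l)
  | none => stepAtom (Finset.mem_insert_self k s)
  | some l => (hd l).mono (Finset.subset_insert k s)

/-- The point of freshness: setting `E` to the start of a loop iteration does not change the outer
goal `d`. -/
theorem realize_setCst {k : ℕ} (h : CstSupported V s φ) (hk : k ∉ s) (η : Cst n → V)
    (x y : Fin n → V) :
    φ.Realize (Sum.elim (setCst k η x) y) ↔ φ.Realize (Sum.elim η y) :=
  h _ _ y fun e he => if_neg fun h' : e.1 = k => hk (h' ▸ he)

end CstSupported

end Semantics

section Soundness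

variable {𝓛 : FirstOrder.Language.{u, v}} {V : Type w} [𝓛.Structure V] {n m : ℕ}

/-! ### Loop games -/

namespace RPG

variable {Loc : Type} {G : RPG 𝓛 V n m Loc} {l : Loc}

/-- The states of the loop game at `l` that lie in `W` if they are states of `G`, and satisfy `S`
if they are at the fresh location. -/
def loopLift (G : RPG 𝓛 V n m Loc) (l : Loc) (W : Set G.sem.State) (S : Set (Fin n → V)) :
    Set (G.loopGame l).sem.State :=
  fun t : (G.loopGame l).State => match t with
    | ⟨(some l', y), h⟩ => (⟨(l', y), h⟩ : G.State) ∈ W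
    | ⟨(none, y), _⟩ => y ∈ S

theorem loopGame_rel_none {y : Fin n → V} {h : ((G.loopGame l).inv none).Realize y}
    {i : Fin m → V} {a : (G.loopGame l).Updates} {t : (G.loopGame l).State}
    (hr : (G.loopGame l).sem.rel (⟨(none, y), h⟩ : (G.loopGame l).State) i a t) :
    t = ⟨(none, y), h⟩ := by
  obtain ⟨r, hr, hsrc, hu, htgt, -, hx⟩ := hr
  obtain ⟨⟨l', x⟩, h'⟩ := t
  obtain ⟨a, ha⟩ := a
  rcases hr with (⟨t, ht, -, rfl⟩ | ⟨t, ht, -, rfl⟩) | rfl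
  · simp at hsrc
  · simp at hsrc
  · dsimp only at hu htgt hx
    subst hu htgt hx
    rfl

/-- Redirection keeps guard and update, so each move has a counterpart under the same input. Only a
target `l` is replaced by the fresh location, and there `hS` converts `S` back into `W`. -/
theorem exists_loopGame_rel {W : Set G.sem.State} {S : Set (Fin n → V)}
    (hS : ∀ (y : Fin n → V) (h : (G.inv l).Realize y), y ∈ S → (⟨(l, y), h⟩ : G.State) ∈ W)
    {l' : Loc} {y : Fin n → V} {h : (G.inv l').Realize y}
    {i : Fin m → V} {a : G.Updates} {s' : G.State}
    (hr : G.sem.rel (⟨(l', y), h⟩ : G.State) i a s') :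
    ∃ (b : (G.loopGame l).Updates) (t : (G.loopGame l).State),
      (G.loopGame l).sem.rel (⟨(some l', y), h⟩ : (G.loopGame l).State) i b t ∧
        (t ∈ G.loopLift l W S → s' ∈ W) := by
  obtain ⟨r, hr, hsrc, hu, htgt, hg, hx⟩ := hr
  obtain ⟨⟨l₁, x⟩, h'⟩ := s'
  obtain ⟨a, ha⟩ := a
  dsimp only at hsrc hu htgt hg hx
  subst hsrc hu htgt hx
  by_cases hl : r.tgt = l
  · have hmem : (⟨some r.src, r.guard, r.update, none⟩ : Transition 𝓛 n m (Option Loc)) ∈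
        (G.loopGame l).trans := Or.inl (Or.inr ⟨r, hr, hl, rfl⟩)
    subst hl
    exact ⟨⟨r.update, _, hmem, rfl⟩, ⟨(none, _), h'⟩, ⟨_, hmem, rfl, rfl, rfl, hg, rfl⟩,
      fun ht => hS _ h' ht⟩
  · have hmem : (⟨some r.src, r.guard, r.update, some r.tgt⟩ : Transition 𝓛 n m (Option Loc)) ∈
        (G.loopGame l).trans := Or.inl (Or.inl ⟨r, hr, hl, rfl⟩)
    exact ⟨⟨r.update, _, hmem, rfl⟩, ⟨(some r.tgt, _), h'⟩, ⟨_, hmem, rfl, rfl, rfl, hg, rfl⟩,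
      fun ht => ht⟩

theorem exists_rel_of_loopGame_rel {W : Set G.sem.State} {S : Set (Fin n → V)}
    (hS : ∀ (y : Fin n → V) (h : (G.inv l).Realize y), y ∈ S → (⟨(l, y), h⟩ : G.State) ∈ W)
    {l' : Loc} {y : Fin n → V} {h : (G.inv l').Realize y}
    {i : Fin m → V} {b : (G.loopGame l).Updates} {t : (G.loopGame l).State}
    (hr : (G.loopGame l).sem.rel (⟨(some l', y), h⟩ : (G.loopGame l).State) i b t) :
    ∃ (a : G.Updates) (s' : G.State), G.sem.rel (⟨(l', y), h⟩ : G.State) i a s' ∧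
      (t ∈ G.loopLift l W S → s' ∈ W) := by
  obtain ⟨r, hr, hsrc, hu, htgt, hg, hx⟩ := hr
  obtain ⟨⟨l₁, x⟩, h'⟩ := t
  obtain ⟨b, hb⟩ := b
  rcases hr with (⟨r, hr, -, rfl⟩ | ⟨r, hr, hl, rfl⟩) | rfl
  · dsimp only at hsrc hu htgt hg hx
    cases hsrc
    subst hu htgt hx
    exact ⟨⟨r.update, r, hr, rfl⟩, ⟨(r.tgt, _), h'⟩, ⟨r, hr, rfl, rfl, rfl, hg, rfl⟩,
      fun ht => ht⟩
  · dsimp only at hsrc hu htgt hg hx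
    cases hsrc
    subst hu htgt hx hl
    exact ⟨⟨r.update, r, hr, rfl⟩, ⟨(r.tgt, _), h'⟩, ⟨r, hr, rfl, rfl, rfl, hg, rfl⟩,
      fun ht => hS _ h' ht⟩
  · simp at hsrc

/-- Closure passes to the loop game because moves correspond in both directions at the old
locations, while the fresh location is absorbing. -/
theorem pre_loopLift_subset {W : Set G.sem.State} {S : Set (Fin n → V)}
    (hS : ∀ (y : Fin n → V) (h : (G.inv l).Realize y), y ∈ S → (⟨(l, y), h⟩ : G.State) ∈ W)
    {p : Player} (hW : G.sem.pre p W ⊆ W) :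
    (G.loopGame l).sem.pre p (G.loopLift l W S) ⊆ G.loopLift l W S := by
  rintro ⟨⟨_ | l', y⟩, h⟩ ht
  · cases p with
    | env =>
      obtain ⟨i, ⟨a, t, hr⟩, ht⟩ := ht
      have := ht a t hr
      rwa [loopGame_rel_none hr] at this
    | sys =>
      -- Without some enabled input the forcing condition of Sys would be vacuous.
      obtain ⟨i, a, t, hr⟩ := (G.loopGame l).sem.exists_succ
        (⟨(none, y), h⟩ : (G.loopGame l).State)
      obtain ⟨a', t', hr', ht'⟩ := ht i ⟨a, t, hr⟩
      rwa [loopGame_rel_none hr'] at ht'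
  · refine hW ?_
    cases p with
    | env =>
      obtain ⟨i, ⟨a, t, hr⟩, ht⟩ := ht
      obtain ⟨a', s', hr', -⟩ := exists_rel_of_loopGame_rel hS hr
      refine ⟨i, ⟨a', s', hr'⟩, fun a s' hr => ?_⟩
      obtain ⟨b, t, hr', h'⟩ := exists_loopGame_rel hS hr
      exact h' (ht b t hr')
    | sys =>
      rintro i ⟨a, s', hr⟩
      obtain ⟨b, t, hr', -⟩ := exists_loopGame_rel hS hr
      obtain ⟨b, t, hr', h'⟩ := ht i ⟨b, t, hr'⟩
      obtain ⟨a, s', hr, hs'⟩ := exists_rel_of_loopGame_rel hS hr'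
      exact ⟨a, s', hr, hs' h'⟩

theorem InputEnabled.loopGame (hG : G.InputEnabled) (l : Loc) : (G.loopGame l).InputEnabled := by
  rintro ⟨⟨_ | l', y⟩, h⟩
  · refine Set.eq_univ_of_forall fun i => ?_
    have hmem : (⟨none, ⊤, fun x => Term.var (Sum.inl x), none⟩ :
        Transition 𝓛 n m (Option Loc)) ∈ (G.loopGame l).trans := Or.inr rfl
    exact ⟨⟨_, _, hmem, rfl⟩, ⟨(none, y), h⟩, _, hmem, rfl, rfl, rfl,
      Formula.realize_top.2 trivial, rfl⟩
  · refine Set.eq_univ_of_forall fun i => ?_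
    have hi : i ∈ G.sem.enabledEnv (⟨(l', y), h⟩ : G.State) :=
      (hG _).symm ▸ Set.mem_univ (α := Fin m → V) i
    obtain ⟨a, s', hr⟩ := hi
    -- Only the existence of a move matters here, so the sets are chosen to make the side condition
    -- trivial.
    obtain ⟨b, t, hr', -⟩ := exists_loopGame_rel (l := l) (W := Set.univ) (S := ∅)
      (fun _ _ _ => trivial) hr
    exact ⟨b, t, hr'⟩

end RPG

/-! ### Soundness of the acceleration procedures -/

variable [(lemmaLang n).Structure V]

/-- The interpretation of every triple of lemma symbols has the properties of an acceleration
lemma. -/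
structure InterpretsAccLemmas (V : Type w) (n : ℕ) [(lemmaLang n).Structure V] : Prop where
  reaches_base : ∀ (k : ℕ) (α : ℕ → Fin n → V), ConcHolds k (α 0) →
    (∀ i, StepHolds k (α i) (α (i + 1))) → ∃ j, BaseHolds k (α j)
  conc_step : ∀ (k : ℕ) (x x' : Fin n → V), ConcHolds k x → ¬ BaseHolds k x →
    StepHolds k x x' → ConcHolds k x'

/-- A failure of `Q` would reproduce itself along `step` forever, while `base` never holds because
it would give `Q`. -/
theorem InterpretsAccLemmas.forall_of_step {k : ℕ} (hV : InterpretsAccLemmas V n)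
    {P Q : (Fin n → V) → Prop} (hbase : ∀ x, P x → BaseHolds k x → Q x)
    (hstep : ∀ x, P x → ConcHolds k x → ¬ Q x → ∃ y, P y ∧ StepHolds k x y ∧ ¬ Q y)
    (x : Fin n → V) (hP : P x) (hc : ConcHolds k x) : Q x := by
  by_contra hQ
  have key : ∀ z : {x // P x ∧ ConcHolds k x ∧ ¬ Q x},
      ∃ z' : {x // P x ∧ ConcHolds k x ∧ ¬ Q x}, StepHolds k z.1 z'.1 := by
    rintro ⟨x, hP, hc, hQ⟩
    obtain ⟨y, hPy, hxy, hQy⟩ := hstep x hP hc hQ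
    exact ⟨⟨y, hPy, hV.conc_step k x y hc (fun hb => hQ (hbase x hP hb)) hxy, hQy⟩, hxy⟩
  choose f hf using key
  let α : ℕ → {x // P x ∧ ConcHolds k x ∧ ¬ Q x} := fun j => f^[j] ⟨x, hP, hc, hQ⟩
  obtain ⟨j, hj⟩ := hV.reaches_base k (fun j => (α j).1) hc fun i => by
    have : α (i + 1) = f (α i) := Function.iterate_succ_apply' f i _
    rw [this]
    exact hf _
  exact (α j).2.2.2 (hbase _ (α j).2.1 hj)

theorem accelerate_subset_lfpAttr {Loc : Type} {G : RPG 𝓛 V n m Loc} {p : Player} {l : Loc}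
    {d : Loc → AccFormula 𝓛 n} {s : Finset ℕ} {k : ℕ} (hV : InterpretsAccLemmas V n)
    (hd : ∀ l, CstSupported V s (d l)) (hk : k ∉ s) (η : Cst n → V)
    (hbase : ∀ x : Fin n → V, (G.inv l).Realize x → BaseHolds k x →
      (d l).Realize (Sum.elim η x))
    (hconc : ∀ (x : Fin n → V) (hx : (G.inv l).Realize x), ¬ (d l).Realize (Sum.elim η x) →
      ConcHolds k x → (⟨(some l, x), hx⟩ : (G.loopGame l).State) ∈
        (G.loopGame l).sem.lfpAttr p
          ((G.loopGame l).denoteAcc (loopGoal k d) (setCst k η x)))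
    (x : Fin n → V) (hx : (G.inv l).Realize x) (hc : ConcHolds k x) :
    (⟨(l, x), hx⟩ : G.State) ∈ G.sem.lfpAttr p (G.denoteAcc d η) := by
  refine hV.forall_of_step (P := fun x => (G.inv l).Realize x)
    -- A state carries a proof of its invariant; quantifying over it makes membership a predicate on
    -- assignments.
    (Q := fun x => ∀ hx : (G.inv l).Realize x,
      (⟨(l, x), hx⟩ : G.State) ∈ G.sem.lfpAttr p (G.denoteAcc d η))
    (fun x hx hb _ => GameStructure.subset_lfpAttr _ _ (hbase x hx hb)) ?_ x hx hc hx
  intro x hx hc hQ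
  -- Assume that every `step`-successor satisfying the invariant is already in the attractor.
  by_contra! hstep
  refine hQ fun hx => ?_
  by_cases hdx : (d l).Realize (Sum.elim η x)
  · exact GameStructure.subset_lfpAttr _ _ hdx
  · have hS : ∀ (y : Fin n → V) (h : (G.inv l).Realize y), y ∈ {y | StepHolds k x y} →
        (⟨(l, y), h⟩ : G.State) ∈ G.sem.lfpAttr p (G.denoteAcc d η) :=
      fun y h hy => hstep y h hy h
    -- Induction on the loop attractor with the lifted set as invariant; at `(some l, x)` it says
    -- that `(l, x)` is in the outer attractor.
    refine GameStructure.lfpAttr_subset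
      (X := G.loopLift l (G.sem.lfpAttr p (G.denoteAcc d η)) {y | StepHolds k x y}) ?_
      (RPG.pre_loopLift_subset hS (GameStructure.pre_lfpAttr_subset _ _)) (hconc x hx hdx hc)
    rintro ⟨⟨_ | l', y⟩, h⟩ ht
    · have ht : StepHolds k (fun z => setCst k η x (k, z)) y := (realize_stepAtom k _ y).1 ht
      simp only [setCst, if_true] at ht
      exact ht
    · exact GameStructure.subset_lfpAttr _ _ (((hd l').realize_setCst hk η x y).1 ht)

/-- Mutual induction over runs. For `IterA` the invariant is that the final constraint implies the
initial one, and that under it the final set lies in the attractor of the initial one, both at the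
same `η`. Tracking the supported constants and the growth of the used indices keeps later fresh
symbols independent of the accumulated goal. -/
theorem AccA.sound (hV : InterpretsAccLemmas V n) {s s' : Finset ℕ} {Loc : Type}
    {G : RPG 𝓛 V n m Loc} {p : Player} {l : Loc} {d : Loc → AccFormula 𝓛 n}
    {Ψ : Constraint 𝓛 n} {φ : AccFormula 𝓛 n} (hrun : AccA s G p l d Ψ φ s') :
    (p = Player.env → G.InputEnabled) → (∀ l, CstSupported V s (d l)) →
    s ⊆ s' ∧ CstSupported V s φ ∧ ∀ η : Cst n → V, Ψ.Realize η →
      ∀ (x : Fin n → V) (hx : (G.inv l).Realize x), φ.Realize (Sum.elim η x) →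
        (⟨(l, x), hx⟩ : G.State) ∈ G.sem.lfpAttr p (G.denoteAcc d η) := by
  classical
  refine AccA.rec
    (motive_1 := fun s _ G p l d Ψ φ s' _ =>
      (p = Player.env → G.InputEnabled) → (∀ l, CstSupported V s (d l)) →
      s ⊆ s' ∧ CstSupported V s φ ∧ ∀ η : Cst n → V, Ψ.Realize η →
        ∀ (x : Fin n → V) (hx : (G.inv l).Realize x), φ.Realize (Sum.elim η x) →
          (⟨(l, x), hx⟩ : G.State) ∈ G.sem.lfpAttr p (G.denoteAcc d η))
    (motive_2 := fun s _ G p Ψ d Ψ' a s' _ =>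
      (p = Player.env → G.InputEnabled) → (∀ l, CstSupported V s (d l)) →
      s ⊆ s' ∧ ∀ η : Cst n → V, Ψ'.Realize η →
        Ψ.Realize η ∧ G.denoteAcc a η ⊆ G.sem.lfpAttr p (G.denoteAcc d η))
    ?_ ?_ ?_ ?_ hrun
  · intro s s' Loc G p l d Ψrec a k fresh _ ih hp hd
    obtain ⟨hss, ih⟩ := ih (fun h => (hp h).loopGame l) (CstSupported.loopGoal hd k)
    refine ⟨(Finset.subset_insert k s).trans hss, CstSupported.conc_inf_liftFormula k _, ?_⟩
    intro η hΨ x hx hφ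
    rw [realize_accConstraint] at hΨ
    rw [Formula.realize_inf, realize_concAtom] at hφ
    refine accelerate_subset_lfpAttr hV hd fresh η hΨ.1 ?_ x hx hφ.1
    intro x hx hdx hc
    obtain ⟨hΨrec, ha⟩ := hΨ.2 x hx hdx hc
    -- The recursive claim is used at the modified interpretation with `E := x`, which is why it
    -- must hold for every `η`.
    exact (ih _ hΨrec).2 ha
  · intro s Loc G p Ψ d _ _
    exact ⟨subset_rfl, fun η hΨ => ⟨hΨ, GameStructure.subset_lfpAttr _ _⟩⟩
  · intro s s₁ s₂ Loc G p Ψ Ψrec Ψ' d a φ l _ _ ih₁ ih₂ hp hd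
    obtain ⟨hs₁, hφ, ih₁⟩ := ih₁ hp hd
    have hd' : ∀ l', CstSupported V s₁ (Function.update d l (d l ⊔ φ) l') := by
      intro l'
      by_cases h : l' = l
      · subst h
        rw [Function.update_self]
        exact ((hd l').sup hφ).mono hs₁
      · rw [Function.update_of_ne h]
        exact (hd l').mono hs₁
    obtain ⟨hs₂, ih₂⟩ := ih₂ hp hd'
    refine ⟨hs₁.trans hs₂, fun η hΨ' => ?_⟩
    obtain ⟨hΨ, ha⟩ := ih₂ η hΨ'
    rw [Formula.realize_inf] at hΨ
    refine ⟨hΨ.1, ha.trans (GameStructure.lfpAttr_subset_lfpAttr ?_)⟩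
    rintro ⟨⟨l', x⟩, hx⟩ ht
    change (Function.update d l (d l ⊔ φ) l').Realize (Sum.elim η x) at ht
    by_cases h : l' = l
    · subst h
      rw [Function.update_self, Formula.realize_sup] at ht
      rcases ht with ht | ht
      · exact GameStructure.subset_lfpAttr _ _ ht
      · exact ih₁ η hΨ.2 x hx ht
    · rw [Function.update_of_ne h] at ht
      exact GameStructure.subset_lfpAttr _ _ ht
  · intro s s' Loc G p Ψ Ψ' d a _ ih hp hd
    obtain ⟨hs, ih⟩ := ih hp fun l => (hd l).sup (CstSupported.cpre G p hd l)
    refine ⟨hs, fun η hΨ' => ?_⟩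
    obtain ⟨hΨ, ha⟩ := ih η hΨ'
    refine ⟨hΨ, ha.trans (GameStructure.lfpAttr_subset_lfpAttr ?_)⟩
    intro t ht
    rcases Formula.realize_sup.1 ht with ht | ht
    · exact GameStructure.subset_lfpAttr _ _ ht
    · exact GameStructure.pre_lfpAttr_subset _ _ (GameStructure.pre_mono
        (GameStructure.subset_lfpAttr _ _) (RPG.denoteAcc_cpre_subset hp d η ht))

end Soundness

-- Instantiation by acceleration lemmas

theorem interpretsAccLemmas_lemmaStructure {𝓛 : FirstOrder.Language.{u, v}} {V : Type w}
    [𝓛.Structure V] {n : ℕ} (lam : ℕ → AccLemma 𝓛 V n) :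
    letI := lemmaStructure lam
    InterpretsAccLemmas V n := by
  let := lemmaStructure lam
  have hstep : ∀ (k : ℕ) (x x' : Fin n → V), StepHolds k x x' ↔
      (lam k).step.Realize (Sum.elim x x') := by
    intro k x x'
    change (lam k).step.Realize (Sum.elim (fun y => Fin.append x x' (Fin.castAdd n y))
      (fun y => Fin.append x x' (Fin.natAdd n y))) ↔ _
    simp only [Fin.append_left, Fin.append_right]
  exact
    { reaches_base := fun k α hc hα =>
        (lam k).reaches_base α hc fun i => (hstep k _ _).1 (hα i)
      conc_step := fun k x x' hc hb hs => (lam k).conc_step x x' hc hb ((hstep k _ _).1 hs) }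

theorem mainTheorem2 {𝓛 : FirstOrder.Language.{u, v}} {V : Type w} [𝓛.Structure V] {n m : ℕ}
    {Loc : Type} (G : RPG 𝓛 V n m Loc) (p : Player) (hp : p = Player.env → G.InputEnabled)
    (l : Loc) (d : Loc → 𝓛.Formula (Fin n)) (s s' : Finset ℕ)
    (Ψ : Constraint 𝓛 n) (φ : AccFormula 𝓛 n)
    (hrun : AccA s G p l (fun l' => liftFormula (d l')) Ψ φ s')
    (lam : ℕ → AccLemma 𝓛 V n) (hΨ : Valid V (instLemmas lam Ψ)) :
    G.denoteAt l (instLemmas lam φ) ⊆ G.sem.Attr p (G.denote d) := by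
  let := lemmaStructure lam
  rintro ⟨⟨l', x⟩, hx⟩ ⟨hl, hφ⟩
  dsimp only at hl
  subst hl
  obtain ⟨-, -, h⟩ := AccA.sound (interpretsAccLemmas_lemmaStructure lam) hrun hp
    fun l => CstSupported.liftFormula (d l)
  -- Some interpretation of the constants is needed, and `V` is not assumed nonempty, so the values
  -- are taken from `x`.
  let η : Cst n → V := fun e => x e.2
  have hx := h η ((realize_instLemmas lam Ψ _ _).1 (hΨ η)) x hx
    ((realize_instLemmas lam φ _ _).1 (hφ η))
  have hden : G.denoteAcc (fun l' => liftFormula (d l')) η = G.denote d :=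
    Set.ext fun t => realize_liftFormula _ _ _
  rw [hden] at hx
  exact GameStructure.lfpAttr_subset_Attr p _ hx
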